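/- There exist a finitely generated free group $F$ and a subgroup $G \le F \times F$ that is a subdirect product of the two factors (that is, both coordinate projections $G \to F$ are surjective) such that the first integral homology group $H_1(G,\mathbb{Z})$ (with $G$ acting trivially on $\mathbb{Z}$) is finitely generated as an abelian group, but the group $G$ itself is not finitely generated. -/

import Mathlib

/-- A subgroup `G ≤ A × B` is a subdirect product of `A` and `B` if it projects surjectively
onto each factor. -/
def IsSubdirectProduct {A B : Type*} [Group A] [Group B] (G : Subgroup (A × B)) : Prop :=
  Function.Surjective (fun g : G => (g : A × B).1) ∧
    Function.Surjective (fun g : G => (g : A × B).2)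

/-- The first integral homology group `H₁(G, ℤ)`, with `G` acting trivially on `ℤ`. -/
noncomputable abbrev IntegralH1 (G : Type) [Group G] : ModuleCat ℤ :=
  groupHomology (Rep.trivial ℤ G ℤ) 1

open scoped commutatorElement

/-! Let `G` be the fibre square of `F → F/N`. As `G` is the diagonal times `1 × N`, its
abelianization is finitely generated as soon as `N = [N,F]⟪R⟫` with `R` finite; but `G` is not
finitely generated if `N` is a strictly increasing union of normal subgroups. Both hold for a limit
built from the non-Hopfian group BS(2,3): `N k` is the preimage of `⟪relator⟫` under the `k`-th
iterate of `ψ : a ↦ a²`. The commutator `[sas⁻¹, a]` is killed by `ψ` yet nontrivial in BS(2,3), so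
the chain grows. Modulo `[N,F]⟪relator⟫` it is central, hence trivial (`commutator_conj_eq_one`);
then `σ` inverts `ψ` there, and all of `N` dies (`iSup_N_eq`). -/

/-- The subgroup of pairs `(x, y)` with `x` and `y` congruent modulo the normal subgroup `N`. -/
def fiberSquare {F : Type*} [Group F] (N : Subgroup F) [N.Normal] : Subgroup (F × F) :=
  MonoidHom.eqLocus ((QuotientGroup.mk' N).comp (MonoidHom.fst F F))
    ((QuotientGroup.mk' N).comp (MonoidHom.snd F F))

theorem mem_fiberSquare {F : Type*} [Group F] {N : Subgroup F} [N.Normal] {p : F × F} :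
    p ∈ fiberSquare N ↔ p.1⁻¹ * p.2 ∈ N :=
  QuotientGroup.eq

theorem fiberSquare_isSubdirectProduct {F : Type*} [Group F] (N : Subgroup F) [N.Normal] :
    IsSubdirectProduct (fiberSquare N) :=
  ⟨fun x => ⟨⟨(x, x), mem_fiberSquare.2 (by simp)⟩, rfl⟩,
    fun x => ⟨⟨(x, x), mem_fiberSquare.2 (by simp)⟩, rfl⟩⟩

/-- The diagonal embedding into `fiberSquare N`. -/
def fiberSquareDiag {F : Type*} [Group F] (N : Subgroup F) [N.Normal] : F →* fiberSquare N where
  toFun x := ⟨(x, x), mem_fiberSquare.2 (by simp)⟩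
  map_one' := rfl
  map_mul' _ _ := rfl

/-- The embedding of `N` into the second factor of `fiberSquare N`. -/
def fiberSquareInr {F : Type*} [Group F] (N : Subgroup F) [N.Normal] : N →* fiberSquare N where
  toFun n := ⟨(1, n), mem_fiberSquare.2 (by simp)⟩
  map_one' := rfl
  map_mul' _ _ := by ext <;> simp

theorem fiberSquare_eq_diag_mul_inr {F : Type*} [Group F] (N : Subgroup F) [N.Normal]
    (g : fiberSquare N) :
    g = fiberSquareDiag N (g : F × F).1 *
      fiberSquareInr N ⟨(g : F × F).1⁻¹ * (g : F × F).2, mem_fiberSquare.1 g.2⟩ := by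
  ext <;> simp [fiberSquareDiag, fiberSquareInr]

/-- If `N = [N, F] ⟪R⟫`, then the abelianization of `fiberSquare N` is generated by the images of
the diagonal generators together with the images of `R`. -/
theorem fiberSquare_abelianization_fg {F : Type*} [Group F] (hF : Group.FG F) (N : Subgroup F)
    [N.Normal] (R : Set F) (hR : R.Finite)
    (h : N = ⁅N, (⊤ : Subgroup F)⁆ ⊔ Subgroup.normalClosure R) :
    Group.FG (Abelianization (fiberSquare N)) := by
  have hRN : R ⊆ N := by
    rw [h]
    exact Subgroup.subset_normalClosure.trans (SetLike.coe_subset_coe.2 le_sup_right)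
  obtain ⟨T, hT, hTfin⟩ := Group.fg_iff.1 hF
  let f : fiberSquare N →* Abelianization (fiberSquare N) := Abelianization.of
  let S : Set (Abelianization (fiberSquare N)) :=
    (fun x => f (fiberSquareDiag N x)) '' T ∪
      (fun n => f (fiberSquareInr N n)) '' ((↑) ⁻¹' R : Set N)
  let L := Subgroup.closure S
  have hdiag : ∀ x, f (fiberSquareDiag N x) ∈ L := by
    have : (⊤ : Subgroup F) ≤ L.comap (f.comp (fiberSquareDiag N)) := by
      rw [← hT, Subgroup.closure_le]
      exact fun x hx => Subgroup.subset_closure (Or.inl ⟨x, hx, rfl⟩)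
    exact fun x => this trivial
  let M : Subgroup F := (L.comap (f.comp (fiberSquareInr N))).map N.subtype
  -- Conjugation by `x` on `N` is conjugation by the diagonal element `(x, x)`, invisible in the
  -- abelianization.
  have hconj : ∀ (n : N) (x : F), f (fiberSquareInr N ⟨x * n * x⁻¹, Subgroup.Normal.conj_mem ‹_› _ n.2 x⟩)
      = f (fiberSquareInr N n) := by
    intro n x
    have : fiberSquareInr N ⟨x * n * x⁻¹, Subgroup.Normal.conj_mem ‹_› _ n.2 x⟩
        = fiberSquareDiag N x * fiberSquareInr N n * (fiberSquareDiag N x)⁻¹ := by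
      ext <;> simp [fiberSquareDiag, fiberSquareInr]
    rw [this, map_mul, map_mul, map_inv, mul_right_comm, mul_inv_cancel, one_mul]
  have hM : M.Normal := by
    refine ⟨?_⟩
    rintro _ ⟨n, hn, rfl⟩ x
    refine ⟨⟨x * n * x⁻¹, Subgroup.Normal.conj_mem ‹_› _ n.2 x⟩, ?_, rfl⟩
    change f _ ∈ L
    rw [hconj]
    exact hn
  have hNM : N ≤ M := by
    conv_lhs => rw [h]
    refine sup_le (Subgroup.commutator_le.2 ?_) (Subgroup.normalClosure_le_normal ?_)
    · intro n hn x _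
      refine ⟨⟨n, hn⟩ * ⟨x * n * x⁻¹, Subgroup.Normal.conj_mem ‹_› _ hn x⟩⁻¹, ?_, ?_⟩
      · change f (fiberSquareInr N _) ∈ L
        rw [map_mul, map_mul, map_inv, map_inv, hconj ⟨n, hn⟩ x, mul_inv_cancel]
        exact one_mem _
      · simp [commutatorElement_def, mul_assoc]
    · intro n hn
      exact ⟨⟨n, hRN hn⟩, Subgroup.subset_closure (Or.inr ⟨⟨n, hRN hn⟩, hn, rfl⟩), rfl⟩
  refine Group.fg_iff.2 ⟨S, ?_, (hTfin.image _).union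
    ((hR.preimage Subtype.val_injective.injOn).image _)⟩
  refine (Subgroup.eq_top_iff' _).2 fun c => ?_
  obtain ⟨g, rfl⟩ := QuotientGroup.mk_surjective c
  change f g ∈ L
  rw [fiberSquare_eq_diag_mul_inr N g, map_mul]
  refine mul_mem (hdiag _) ?_
  obtain ⟨n, hn, hn'⟩ := hNM (mem_fiberSquare.1 g.2)
  have : n = ⟨(g : F × F).1⁻¹ * (g : F × F).2, mem_fiberSquare.1 g.2⟩ := Subtype.ext hn'
  rw [← this]
  exact hn

/-- If `N` is a strictly increasing union of normal subgroups, then `fiberSquare N` is not finitely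
generated. -/
theorem fiberSquare_not_fg {F : Type*} [Group F] (N : ℕ → Subgroup F) [∀ k, (N k).Normal]
    (hN : StrictMono N) : ¬ Group.FG (fiberSquare (⨆ k, N k)) := by
  intro h
  rw [Group.fg_iff_subgroup_fg] at h
  obtain ⟨S, hS⟩ := h
  have hmem : ∀ p : F × F, ∃ k, p ∈ S → p ∈ fiberSquare (N k) := by
    intro p
    by_cases hp : p ∈ S
    · have h1 : p ∈ fiberSquare (⨆ k, N k) := hS ▸ Subgroup.subset_closure hp
      obtain ⟨k, hk⟩ := (Subgroup.mem_iSup_of_directed hN.monotone.directed_le).1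
        (mem_fiberSquare.1 h1)
      exact ⟨k, fun _ => mem_fiberSquare.2 hk⟩
    · exact ⟨0, fun hp' => absurd hp' hp⟩
  choose k hk using hmem
  -- Finitely many generators already lie in one stage.
  have hle : fiberSquare (⨆ k, N k) ≤ fiberSquare (N (S.sup k)) := by
    rw [← hS, Subgroup.closure_le]
    exact fun p hp => mem_fiberSquare.2
      (hN.monotone (Finset.le_sup hp) (mem_fiberSquare.1 (hk p hp)))
  refine (hN (Nat.lt_succ_self (S.sup k))).not_ge fun x hx => ?_
  have := hle (show ((1 : F), x) ∈ fiberSquare (⨆ k, N k) from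
    mem_fiberSquare.2 (by simpa using Subgroup.mem_iSup_of_mem _ hx))
  simpa using mem_fiberSquare.1 this

theorem integralH1_finite (G : Type) [Group G] (h : Group.FG (Abelianization G)) :
    Module.Finite ℤ (IntegralH1 G) := by
  have : Module.Finite ℤ (Additive (Abelianization G)) :=
    Module.Finite.iff_addGroup_fg.2 (GroupFG.iff_add_fg.1 h)
  have : Module.Finite ℤ (Rep.trivial ℤ G ℤ) := Module.Finite.self ℤ
  have : Module.Finite ℤ (TensorProduct ℤ (Additive (Abelianization G)) (Rep.trivial ℤ G ℤ)) :=
    Module.Finite.tensorProduct ℤ _ _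
  have := Module.Finite.equiv
    (groupHomology.H1AddEquivOfIsTrivial (Rep.trivial ℤ G ℤ)).symm.toIntLinearEquiv
  exact this

/-! ### The Baumslag–Solitar relation and its commutator -/

section BaumslagSolitar

variable {E : Type*} [Group E] {x y : E}

theorem conj_sq_eq_cube (h : y * x ^ 2 * y⁻¹ = x ^ 3) : (y * x * y⁻¹) ^ 2 = x ^ 3 := by
  rw [conj_pow, h]

/-- Put `b = yxy⁻¹` and `c = [b, x]`, so `bx = cxb` and `b² = x³`. As `b²` commutes with `x`, `c² =
1`; as `x³` commutes with `b`, `c³ = 1`. -/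
theorem commutator_conj_eq_one (h : y * x ^ 2 * y⁻¹ = x ^ 3)
    (hc : ∀ z, Commute ⁅y * x * y⁻¹, x⁆ z) : ⁅y * x * y⁻¹, x⁆ = 1 := by
  have hb := conj_sq_eq_cube h
  generalize y * x * y⁻¹ = b at hb hc ⊢
  have e : b * x = ⁅b, x⁆ * (x * b) := by simp [commutatorElement_def, mul_assoc]
  generalize ⁅b, x⁆ = c at e hc ⊢
  have h2 : c ^ 2 = 1 := by
    have e2 : b ^ 2 * x = c ^ 2 * (x * b ^ 2) := by
      calc b ^ 2 * x = b * (b * x) := by rw [pow_two, mul_assoc]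
        _ = b * c * (x * b) := by rw [e, mul_assoc]
        _ = c * (b * x) * b := by rw [← (hc b).eq]; simp only [mul_assoc]
        _ = c ^ 2 * (x * b ^ 2) := by rw [e]; simp only [pow_two, mul_assoc]
    rw [hb, ← pow_succ, ← pow_succ'] at e2
    exact right_eq_mul.1 e2
  have h3 : c ^ 3 = 1 := by
    have hs : SemiconjBy b x (c * x) := by
      rw [SemiconjBy, e, mul_assoc]
    have e3 := (hs.pow_right 3).eq
    rw [(hc x).mul_pow, ← hb, ← pow_succ', mul_assoc, ← pow_succ] at e3
    exact right_eq_mul.1 e3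
  simpa [pow_succ _ 2, h2] using h3

theorem conj_mul_inv_sq (h : y * x ^ 2 * y⁻¹ = x ^ 3) (hc : ⁅y * x * y⁻¹, x⁆ = 1) :
    (y * x * y⁻¹ * x⁻¹) ^ 2 = x := by
  have : Commute (y * x * y⁻¹) x⁻¹ := (commutatorElement_eq_one_iff_commute.1 hc).inv_right
  rw [this.mul_pow, conj_sq_eq_cube h]
  group

theorem conj_mul_inv_relation (h : y * x ^ 2 * y⁻¹ = x ^ 3) (hc : ⁅y * x * y⁻¹, x⁆ = 1) :
    y * (y * x * y⁻¹ * x⁻¹) ^ 2 * y⁻¹ = (y * x * y⁻¹ * x⁻¹) ^ 3 := by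
  rw [pow_succ' _ 2, conj_mul_inv_sq h hc]
  group

/-- In `HNNExtension ℤ (2ℤ) (3ℤ)` the commutator of `t a t⁻¹` and `a` is nontrivial, although the
Baumslag–Solitar relation holds. -/
theorem exists_baumslagSolitar_commutator_ne_one :
    ∃ (E : Type) (_ : Group E) (x y : E),
      y * x ^ 2 * y⁻¹ = x ^ 3 ∧ ⁅y * x * y⁻¹, x⁆ ≠ 1 := by
  let Z := Multiplicative ℤ
  let p (n : ℕ) : Z →* Z := powMonoidHom n
  have hp : ∀ n, n ≠ 0 → Function.Injective (p n) := fun n hn u v huv => by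
    have : n • Multiplicative.toAdd u = n • Multiplicative.toAdd v := huv
    simpa [hn] using this
  let A := (p 2).range
  let B := (p 3).range
  let φ : A ≃* B := ((p 2).ofInjective (hp 2 (by norm_num))).symm.trans
    ((p 3).ofInjective (hp 3 (by norm_num)))
  let a : Z := Multiplicative.ofAdd 1
  have hφ : φ ⟨a ^ 2, a, rfl⟩ = ⟨a ^ 3, a, rfl⟩ := by
    have : (⟨a ^ 2, a, rfl⟩ : A) = (p 2).ofInjective (hp 2 (by norm_num)) a := rfl
    rw [this]
    simp only [φ, MulEquiv.trans_apply, MulEquiv.symm_apply_apply]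
    rfl
  have hA : a ∉ A := by
    rintro ⟨u, hu⟩
    have : 2 • Multiplicative.toAdd u = 1 := hu
    rw [nsmul_eq_mul] at this
    push_cast at this
    omega
  have hB : a ∉ B := by
    rintro ⟨u, hu⟩
    have : 3 • Multiplicative.toAdd u = 1 := hu
    rw [nsmul_eq_mul] at this
    push_cast at this
    omega
  let of : Z →* HNNExtension Z A B φ := HNNExtension.of
  let t : HNNExtension Z A B φ := HNNExtension.t
  refine ⟨HNNExtension Z A B φ, inferInstance, of a, t, ?_, ?_⟩
  · have := HNNExtension.equiv_eq_conj (φ := φ) ⟨a ^ 2, a, rfl⟩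
    rw [hφ] at this
    simpa only [map_pow] using this.symm
  · intro h
    -- The commutator spelled out as a word; it has no pinch because `a` lies in neither `2ℤ` nor
    -- `3ℤ`, so Britton's lemma applies.
    let w : HNNExtension.NormalWord.ReducedWord Z A B :=
      { head := 1
        toList := [(1, a), (-1, a), (1, a⁻¹), (-1, a⁻¹)]
        chain := by
          have hA' : a⁻¹ ∉ A := fun h => hA (inv_mem_iff.1 h)
          simp [hA, hB, hA'] }
    have hw : w.prod φ = ⁅t * of a * t⁻¹, of a⁆ := by
      simp [HNNExtension.NormalWord.ReducedWord.prod, w, commutatorElement_def, mul_assoc, t, of]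
    have := HNNExtension.ReducedWord.toList_eq_nil_of_mem_of_range (φ := φ) w
      (by rw [hw, h]; exact one_mem _)
    simp [w] at this

end BaumslagSolitar

/-! ### The chain of normal subgroups -/

namespace BaumslagSolitarFiber

/-- The free group of rank two. -/
abbrev F := FreeGroup (Fin 2)

/-- The first generator. -/
abbrev a : F := FreeGroup.of 0

/-- The second generator. -/
abbrev s : F := FreeGroup.of 1

/-- The Baumslag–Solitar relator `s a² s⁻¹ a⁻³`. -/
def relator : F := s * a ^ 2 * s⁻¹ * (a ^ 3)⁻¹

/-- The endomorphism `a ↦ a²`, `s ↦ s`. -/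
def ψ : F →* F := FreeGroup.lift ![a ^ 2, s]

/-- The endomorphism `a ↦ s a s⁻¹ a⁻¹`, `s ↦ s`. -/
def σ : F →* F := FreeGroup.lift ![s * a * s⁻¹ * a⁻¹, s]

@[simp] theorem ψ_a : ψ a = a ^ 2 := by simp [ψ]
@[simp] theorem ψ_s : ψ s = s := by simp [ψ]
@[simp] theorem σ_a : σ a = s * a * s⁻¹ * a⁻¹ := by simp [σ]
@[simp] theorem σ_s : σ s = s := by simp [σ]

theorem map_relator_eq_one_iff {E : Type*} [Group E] (f : F →* E) :
    f relator = 1 ↔ f s * f a ^ 2 * (f s)⁻¹ = f a ^ 3 := by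
  rw [relator, map_mul, map_inv, mul_inv_eq_one]
  simp only [map_mul, map_pow, map_inv]

/-- The preimages of the normal closure of the relator under the iterates of `ψ`. -/
def N : ℕ → Subgroup F
  | 0 => Subgroup.normalClosure {relator}
  | k + 1 => (N k).comap ψ

instance N_normal : ∀ k, (N k).Normal
  | 0 => Subgroup.normalClosure_normal
  | k + 1 => (N_normal k).comap ψ

theorem relation_of_relator_mem {K : Subgroup F} [K.Normal] (h : relator ∈ K) :
    (s : F ⧸ K) * (a : F ⧸ K) ^ 2 * (s : F ⧸ K)⁻¹ = (a : F ⧸ K) ^ 3 :=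
  (map_relator_eq_one_iff (QuotientGroup.mk' K)).1 ((QuotientGroup.eq_one_iff _).2 h)

theorem relator_mem : relator ∈ N 0 := Subgroup.subset_normalClosure rfl

theorem N_zero_le_of_mem {K : Subgroup F} [K.Normal] (h : relator ∈ K) : N 0 ≤ K :=
  Subgroup.normalClosure_le_normal (Set.singleton_subset_iff.2 h)

/-- `ψ` respects the relation: squaring both sides gives `sa⁴s⁻¹ = a⁶`. -/
theorem N_zero_le_one : N 0 ≤ N 1 := by
  refine N_zero_le_of_mem (K := N 1) ?_
  have h := relation_of_relator_mem relator_mem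
  change ψ relator ∈ N 0
  rw [← QuotientGroup.eq_one_iff]
  refine (map_relator_eq_one_iff ((QuotientGroup.mk' (N 0)).comp ψ)).2 ?_
  simp only [MonoidHom.comp_apply, ψ_a, ψ_s, map_pow, QuotientGroup.mk'_apply]
  rw [← conj_pow, h, ← pow_mul, ← pow_mul]

theorem N_monotone : Monotone N :=
  monotone_nat_of_le_succ fun k => by
    induction k with
    | zero => exact N_zero_le_one
    | succ k ih => exact Subgroup.comap_mono ih

/-- In BS(2,3), `ψ (σ a) = sa²s⁻¹a⁻² = a`, so `σ` is a section of `ψ`; it carries new elements one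
stage up. -/
theorem ψ_σ_mul_inv_mem (g : F) : (ψ (σ g))⁻¹ * g ∈ N 0 := by
  rw [← QuotientGroup.eq]
  have h := relation_of_relator_mem relator_mem
  refine DFunLike.congr_fun (f := ((QuotientGroup.mk' (N 0)).comp (ψ.comp σ)))
    (g := QuotientGroup.mk' (N 0)) (FreeGroup.ext_hom _ _ fun i => ?_) g
  fin_cases i
  · change QuotientGroup.mk' (N 0) (ψ (σ a)) = QuotientGroup.mk' (N 0) a
    simp only [σ_a, map_mul, map_inv, ψ_a, ψ_s, map_pow, QuotientGroup.mk'_apply]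
    rw [h]
    group
  · change QuotientGroup.mk' (N 0) (ψ (σ s)) = QuotientGroup.mk' (N 0) s
    simp

theorem σ_mem_succ {k : ℕ} {g : F} (hg : g ∈ N k) : σ g ∈ N (k + 1) := by
  change ψ (σ g) ∈ N k
  have := N_monotone (Nat.zero_le k) (ψ_σ_mul_inv_mem g)
  simpa using (N k).mul_mem hg ((N k).inv_mem this)

theorem σ_mem_succ_iff {k : ℕ} {g : F} : σ g ∈ N (k + 1) ↔ g ∈ N k := by
  refine ⟨fun h => ?_, σ_mem_succ⟩
  have := N_monotone (Nat.zero_le k) (ψ_σ_mul_inv_mem g)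
  simpa using (N k).mul_mem (show ψ (σ g) ∈ N k from h) this

theorem commutator_mem_one : ⁅s * a * s⁻¹, a⁆ ∈ N 1 := by
  change ψ _ ∈ N 0
  rw [← QuotientGroup.eq_one_iff]
  have h := relation_of_relator_mem relator_mem
  change QuotientGroup.mk' (N 0) _ = 1
  simp only [map_commutatorElement, map_mul, map_inv, ψ_a, ψ_s, map_pow, QuotientGroup.mk'_apply]
  rw [h, commutatorElement_eq_one_iff_commute]
  exact (Commute.refl _).pow_pow _ _

theorem commutator_notMem_zero : ⁅s * a * s⁻¹, a⁆ ∉ N 0 := by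
  obtain ⟨E, _, x, y, h, hc⟩ := exists_baumslagSolitar_commutator_ne_one
  let f : F →* E := FreeGroup.lift ![x, y]
  have fa : f a = x := by simp [f]
  have fs : f s = y := by simp [f]
  have hle : N 0 ≤ f.ker := N_zero_le_of_mem (f.mem_ker.2
    ((map_relator_eq_one_iff f).2 (by rwa [fa, fs])))
  intro hmem
  refine hc ?_
  simpa only [map_commutatorElement, map_mul, map_inv, fa, fs] using f.mem_ker.1 (hle hmem)

theorem N_strictMono : StrictMono N := by
  have key : ∀ k, ∃ g, g ∈ N (k + 1) ∧ g ∉ N k := by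
    intro k
    induction k with
    | zero => exact ⟨_, commutator_mem_one, commutator_notMem_zero⟩
    | succ k ih =>
      obtain ⟨g, h1, h2⟩ := ih
      exact ⟨σ g, σ_mem_succ h1, fun h => h2 (σ_mem_succ_iff.1 h)⟩
  refine strictMono_nat_of_lt_succ fun k => ?_
  obtain ⟨g, h1, h2⟩ := key k
  exact lt_of_le_of_ne (N_monotone k.le_succ) fun h => h2 (h ▸ h1)

theorem mem_iSup_N {g : F} : g ∈ ⨆ k, N k ↔ ∃ k, g ∈ N k :=
  Subgroup.mem_iSup_of_directed N_monotone.directed_le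

theorem iSup_N_eq :
    ⨆ k, N k = ⁅⨆ k, N k, (⊤ : Subgroup F)⁆ ⊔ Subgroup.normalClosure {relator} := by
  set K : Subgroup F := ⁅⨆ k, N k, (⊤ : Subgroup F)⁆ ⊔ Subgroup.normalClosure {relator} with hK
  have hKn : K.Normal := by rw [hK]; infer_instance
  have h0 : N 0 ≤ K := le_sup_right
  have hcomm : ∀ n ∈ ⨆ k, N k, ∀ g, ⁅n, g⁆ ∈ K := fun n hn g =>
    (le_sup_left : _ ≤ K) (Subgroup.commutator_mem_commutator hn trivial)
  have h := relation_of_relator_mem (h0 relator_mem)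
  have hc : ⁅(s : F ⧸ K) * a * (s : F ⧸ K)⁻¹, (a : F ⧸ K)⁆ = 1 := by
    refine commutator_conj_eq_one h fun z => ?_
    obtain ⟨g, rfl⟩ := QuotientGroup.mk_surjective z
    rw [← commutatorElement_eq_one_iff_commute]
    exact (QuotientGroup.eq_one_iff (N := K) _).2
      (hcomm _ (mem_iSup_N.2 ⟨1, commutator_mem_one⟩) g)
  -- `σ` descends to `F ⧸ K`: it moves each `N k` into `N (k + 1)`, and the relation survives
  -- because `c = 1` there.
  have hσK : K ≤ K.comap σ := by
    refine sup_le (Subgroup.commutator_le.2 fun n hn g _ => ?_) (N_zero_le_of_mem ?_)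
    · obtain ⟨k, hk⟩ := mem_iSup_N.1 hn
      rw [Subgroup.mem_comap, map_commutatorElement]
      exact hcomm _ (mem_iSup_N.2 ⟨k + 1, σ_mem_succ hk⟩) _
    · rw [Subgroup.mem_comap, ← QuotientGroup.eq_one_iff]
      refine (map_relator_eq_one_iff ((QuotientGroup.mk' K).comp σ)).2 ?_
      simp only [MonoidHom.comp_apply, σ_a, σ_s, map_mul, map_inv, QuotientGroup.mk'_apply]
      exact conj_mul_inv_relation h hc
  have hσψ : ∀ g, (σ (ψ g))⁻¹ * g ∈ K := by
    intro g
    rw [← QuotientGroup.eq]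
    refine DFunLike.congr_fun (f := ((QuotientGroup.mk' K).comp (σ.comp ψ)))
      (g := QuotientGroup.mk' K) (FreeGroup.ext_hom _ _ fun i => ?_) g
    fin_cases i
    · change QuotientGroup.mk' K (σ (ψ a)) = QuotientGroup.mk' K a
      simp only [σ_a, map_mul, map_inv, ψ_a, map_pow, QuotientGroup.mk'_apply]
      exact conj_mul_inv_sq h hc
    · change QuotientGroup.mk' K (σ (ψ s)) = QuotientGroup.mk' K s
      simp
  refine le_antisymm (iSup_le fun k => ?_) (sup_le ?_ (le_iSup N 0))
  · induction k with
    | zero => exact h0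
    -- `ψ g ∈ K` gives `σ (ψ g) ∈ K`, which is `g` modulo `K`.
    | succ k ih =>
      intro g hg
      simpa using K.mul_mem (hσK (ih (show ψ g ∈ N k from hg))) (hσψ g)
  · exact Subgroup.commutator_le_left _ _

end BaumslagSolitarFiber

theorem mainTheorem12 :
    ∃ (n : ℕ) (G : Subgroup (FreeGroup (Fin n) × FreeGroup (Fin n))),
      IsSubdirectProduct G ∧
      Module.Finite ℤ (IntegralH1 G) ∧
      ¬ Group.FG G :=
  ⟨2, fiberSquare (⨆ k, BaumslagSolitarFiber.N k), fiberSquare_isSubdirectProduct _,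
    integralH1_finite _ (fiberSquare_abelianization_fg inferInstance _ _ (Set.finite_singleton _)
      BaumslagSolitarFiber.iSup_N_eq),
    fiberSquare_not_fg _ BaumslagSolitarFiber.N_strictMono⟩
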